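/- A variety in $\mathbb{C}^n$ is the zero locus of finitely many polynomials in $n$ complex variables; its dimension is the Krull dimension of its coordinate ring, and the empty variety has dimension $-\infty$. A variety $V\subset\mathbb{C}^d$ is called admissible with respect to a set $F$ of linear functions $\mathbb{C}^d\to\mathbb{C}$ if $\dim(V\cap\{a:\ell(a)=0\})<\dim V$ for every $\ell\in F$. Let $L:\mathbb{C}^d\times\mathbb{C}^d\to\mathbb{C}$ be bilinear, let $W\subset\mathbb{C}^d$ be the zero locus of finitely many homogeneous polynomials, and let $V_1,\dots,V_m\subset\mathbb{C}^d$ be varieties, each of which is admissible with respect to the set of linear functions $\{L(\cdot,x): x\in W\setminus\{0\}\}$. Put $V:=V_1\times\cdots\times V_m\subset(\mathbb{C}^d)^m$ and, for $A=(a_1,\dots,a_m)\in V$, $L_A(x):=(L(a_1,x),\dots,L(a_m,x))\in\mathbb{C}^m$. Then the following hold. (i) If $m\ge\dim W$, then there is a variety $Z\subset V$ with $\dim Z\le\dim V-\delta$, where $\delta:=m-\dim W+1$, such that for all $A\in V\setminus Z$ and all $x\in W$, $L_A(x)=0$ implies $x=0$. (If $W=\emptyset$, the dimension bound is read as $Z=\emptyset$.)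 (ii) If $m<\dim W$, then for every $A\in V$ there is a nonzero $x_0\in W$ with $L_A(x_0)=0$. Consequently, if $V\neq\emptyset$, there exists $A\in V$ such that $L_A(x)=0$, $x\in W$, forces $x=0$ if and only if $m\ge\dim W$; that is, $\dim W$ is the exact minimal number of measurements. -/

import Mathlib

/-- The zero locus in `ℂ^σ` of a finite collection of complex polynomials. -/
def IsAlgebraicVariety {σ : Type*} (W : Set (σ → ℂ)) : Prop :=
  ∃ S : Finset (MvPolynomial σ ℂ), W = {x | ∀ p ∈ S, MvPolynomial.eval x p = 0}

/-- The zero locus in `ℂ^σ` of a finite collection of homogeneous complex polynomials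
(of possibly different degrees). -/
def IsHomogeneousVariety {σ : Type*} (W : Set (σ → ℂ)) : Prop :=
  ∃ S : Finset (MvPolynomial σ ℂ), (∀ p ∈ S, ∃ n : ℕ, p.IsHomogeneous n) ∧
    W = {x | ∀ p ∈ S, MvPolynomial.eval x p = 0}

/-- The dimension of an affine variety `W ⊆ ℂ^σ`: the Krull dimension of its coordinate ring
`ℂ[x] / I(W)`. The empty variety has dimension `⊥`. -/
noncomputable def varietyDim {σ : Type*} (W : Set (σ → ℂ)) : WithBot ℕ∞ :=
  ringKrullDim (MvPolynomial σ ℂ ⧸ MvPolynomial.vanishingIdeal ℂ W)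

/-- `V` is admissible with respect to a set of linear functions if cutting it with the kernel of
any of them lowers the dimension. -/
def IsAdmissible {σ : Type*} (V : Set (σ → ℂ)) (F : Set ((σ → ℂ) →ₗ[ℂ] ℂ)) : Prop :=
  ∀ l ∈ F, varietyDim (V ∩ {a | l a = 0}) < varietyDim V

/-- The product `V₁ × ⋯ × V_m ⊆ (ℂ^d)^m`; the `j`-th component of `A ∈ ℂ^{m × d}` is its
`j`-th row `i ↦ A (j, i)`. -/
def productVariety {m d : ℕ} (V : Fin m → Set (Fin d → ℂ)) : Set (Fin m × Fin d → ℂ) :=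
  {A | ∀ j, (fun i => A (j, i)) ∈ V j}

/-- The linear samples `L_A(x) = (L(a₁, x), …, L(a_m, x))`, with `a_j` the `j`-th row of `A`. -/
def linearSamples {m d : ℕ} (L : (Fin d → ℂ) →ₗ[ℂ] (Fin d → ℂ) →ₗ[ℂ] ℂ)
    (A : Fin m × Fin d → ℂ) (x : Fin d → ℂ) : Fin m → ℂ :=
  fun j => L (fun i => A (j, i)) x

/-! ### Krull dimension of finitely generated algebras -/

/-! For (i), the bad `A` are the projections of pairs `(A, x)` with `x ∈ W` nonzero and `L_A(x) =
0`. As `W` is a cone, `x` can be scaled into a chart `W ∩ {x | x i = 1}`, of dimension at most `dim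
W - 1`. The fibre over `x` is the product of the slices `V j ∩ ker L(·, x)`; admissibility costs
every factor a dimension, so it has dimension at most `dim V - m`. The incidence variety thus has
dimension at most `dim V - m + dim W - 1`, and `Z` is the closure of its projections
(`exists_exceptional_variety`).

For (ii), if the forms `L(a_j, ·)` vanish together on `W` at most in the origin, a graded Nakayama
argument makes the coordinate ring of `W` finite over them, whence `dim W ≤ m`
(`varietyDim_le_of_forall_eq_zero`).

The dimension theory comes from Noether normalization (`varietyDim_image_le`,
`varietyDim_productVariety`) and the height inequality for ring maps (`varietyDim_le_add_of_fibre`).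
-/

theorem ringKrullDim_le_of_isIntegral {R S : Type*} [CommRing R] [CommRing S] (f : R →+* S)
    (hf : f.IsIntegral) : ringKrullDim S ≤ ringKrullDim R := by
  algebraize [f]
  refine Order.krullDim_le_of_strictMono (PrimeSpectrum.comap f) fun p q hpq => ?_
  exact Ideal.IsIntegral.comap_lt_comap (R := R) (A := S) hpq

/-- Incomparability gives one inequality; for the other, going up lifts each chain of primes,
starting from a prime over its head. -/
theorem ringKrullDim_eq_of_isIntegral {R S : Type*} [CommRing R] [CommRing S] (f : R →+* S)
    (hf : f.IsIntegral) (hinj : Function.Injective f) : ringKrullDim S = ringKrullDim R := by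
  refine le_antisymm (ringKrullDim_le_of_isIntegral f hf) ?_
  algebraize [f]
  have : FaithfulSMul R S := (faithfulSMul_iff_algebraMap_injective R S).mpr hinj
  refine iSup_le fun l => ?_
  obtain ⟨⟨P, hP, hPl⟩⟩ := Ideal.nonempty_primesOver (S := S) l.head.asIdeal
  obtain ⟨l', hl', -⟩ := Ideal.exists_ltSeries_of_hasGoingUp (S := S) l P
  rw [← hl']
  exact Order.LTSeries.length_le_krullDim l'

theorem exists_ringKrullDim_eq_natCast (k A : Type*) [Field k] [CommRing A] [Nontrivial A]
    [Algebra k A] [Algebra.FiniteType k A] : ∃ s : ℕ, ringKrullDim A = s := by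
  obtain ⟨s, g, hg, hg'⟩ := exists_integral_inj_algHom_of_fg k A
  refine ⟨s, ?_⟩
  rw [ringKrullDim_eq_of_isIntegral g.toRingHom hg' hg]
  simp [MvPolynomial.ringKrullDim_of_isNoetherianRing]

/-- A prime `q` avoiding the images of all nonzero polynomials keeps the `s` variables independent
in the domain `B ⧸ q`, whose transcendence degree is its Krull dimension by Noether normalization.
-/
theorem natCast_le_ringKrullDim_of_injective {k B : Type*} [Field k] [CommRing B]
    [Algebra k B] [Algebra.FiniteType k B] {s : ℕ} (g : MvPolynomial (Fin s) k →ₐ[k] B)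
    (hg : Function.Injective g) : (s : WithBot ℕ∞) ≤ ringKrullDim B := by
  -- a prime of `B` lying over the zero ideal
  obtain ⟨q, hq, hgq⟩ : ∃ q : Ideal B, q.IsPrime ∧ ∀ p, g p ∈ q → p = 0 := by
    have hdisj : Disjoint ((⊥ : Ideal B) : Set B)
        ((nonZeroDivisors (MvPolynomial (Fin s) k)).map g : Submonoid B) := by
      rw [Set.disjoint_left]
      rintro _ hx ⟨p, hp, rfl⟩
      have h0 : g p = 0 := by simpa using hx
      exact nonZeroDivisors.ne_zero hp (hg (by rw [h0, map_zero]))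
    obtain ⟨q, hq, -, hd⟩ := Ideal.exists_le_prime_disjoint _ _ hdisj
    refine ⟨q, hq, fun p hp => ?_⟩
    by_contra hne
    exact Set.disjoint_left.mp hd hp ⟨p, mem_nonZeroDivisors_of_ne_zero hne, rfl⟩
  obtain ⟨r, h, hh, hh'⟩ := exists_integral_inj_algHom_of_fg k (B ⧸ q)
  have hr : ringKrullDim (B ⧸ q) = r := by
    rw [ringKrullDim_eq_of_isIntegral h.toRingHom hh' hh]
    simp [MvPolynomial.ringKrullDim_of_isNoetherianRing]
  have hle : s ≤ r := by
    have h1 : AlgebraicIndependent k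
        (fun i => (Ideal.Quotient.mkₐ k q).comp g (MvPolynomial.X i)) := by
      rw [algebraicIndependent_iff_injective_aeval]
      have : MvPolynomial.aeval (fun i => (Ideal.Quotient.mkₐ k q).comp g (MvPolynomial.X i)) =
          (Ideal.Quotient.mkₐ k q).comp g := by ext; simp
      rw [this, injective_iff_map_eq_zero]
      intro p hp
      exact hgq p (Ideal.Quotient.eq_zero_iff_mem.mp (by simpa using hp))
    have h2 : AlgebraicIndependent k (fun i => h (MvPolynomial.X i)) := by
      rw [algebraicIndependent_iff_injective_aeval]
      have : MvPolynomial.aeval (fun i => h (MvPolynomial.X i)) = h := by ext; simp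
      rwa [this]
    have h3 : IsTranscendenceBasis k (fun i => h (MvPolynomial.X i)) := by
      algebraize [h.toRingHom]
      have : IsScalarTower k (MvPolynomial (Fin r) k) (B ⧸ q) := .of_algHom h
      have : FaithfulSMul (MvPolynomial (Fin r) k) (B ⧸ q) :=
        (faithfulSMul_iff_algebraMap_injective _ _).mpr hh
      exact (IsTranscendenceBasis.mvPolynomial (Fin r) k).algebraMap_comp (A := B ⧸ q)
    have := h1.lift_cardinalMk_le_trdeg
    rw [← h3.lift_cardinalMk_eq_trdeg] at this
    simpa using this
  calc (s : WithBot ℕ∞) ≤ r := by exact_mod_cast hle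
    _ = ringKrullDim (B ⧸ q) := hr.symm
    _ ≤ ringKrullDim B := ringKrullDim_quotient_le q

theorem ringKrullDim_le_of_injective {k A B : Type*} [Field k] [CommRing A] [CommRing B]
    [Algebra k A] [Algebra k B] [Algebra.FiniteType k A] [Algebra.FiniteType k B]
    (f : A →ₐ[k] B) (hf : Function.Injective f) : ringKrullDim A ≤ ringKrullDim B := by
  cases subsingleton_or_nontrivial A
  · simp [ringKrullDim_eq_bot_of_subsingleton]
  obtain ⟨s, g, hg, hg'⟩ := exists_integral_inj_algHom_of_fg k A
  rw [ringKrullDim_eq_of_isIntegral g.toRingHom hg' hg]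
  simpa [MvPolynomial.ringKrullDim_of_isNoetherianRing] using
    natCast_le_ringKrullDim_of_injective (f.comp g) (hf.comp hg)

/-! ### Affine varieties and their dimension -/

open MvPolynomial

section Varieties

variable {σ τ : Type*}

theorem isAlgebraicVariety_zeroLocus [Finite σ] (I : Ideal (MvPolynomial σ ℂ)) :
    IsAlgebraicVariety (zeroLocus ℂ I) := by
  obtain ⟨S, rfl⟩ := (isNoetherianRing_iff_ideal_fg _).mp inferInstance I
  exact ⟨S, zeroLocus_span _⟩

theorem IsAlgebraicVariety.zeroLocus_vanishingIdeal {V : Set (σ → ℂ)}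
    (hV : IsAlgebraicVariety V) : zeroLocus ℂ (vanishingIdeal ℂ V) = V := by
  obtain ⟨S, rfl⟩ := hV
  refine le_antisymm (fun x hx p hp => ?_) (zeroLocus_vanishingIdeal_le _)
  simpa [aeval_eq_eval] using hx p fun y hy => by simpa [aeval_eq_eval] using hy p hp

theorem IsHomogeneousVariety.isAlgebraicVariety {W : Set (σ → ℂ)} (hW : IsHomogeneousVariety W) :
    IsAlgebraicVariety W :=
  let ⟨S, _, h⟩ := hW
  ⟨S, h⟩

theorem isAlgebraicVariety_setOf_eval_eq_zero (p : MvPolynomial σ ℂ) :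
    IsAlgebraicVariety {x | eval x p = 0} :=
  ⟨{p}, by simp⟩

theorem IsAlgebraicVariety.inter {V W : Set (σ → ℂ)} (hV : IsAlgebraicVariety V)
    (hW : IsAlgebraicVariety W) : IsAlgebraicVariety (V ∩ W) := by
  classical
  obtain ⟨S, rfl⟩ := hV
  obtain ⟨T, rfl⟩ := hW
  refine ⟨S ∪ T, ?_⟩
  ext x
  simp only [Set.mem_inter_iff, Set.mem_ofPred_eq, Finset.mem_union]
  exact ⟨fun h p hp => hp.elim (h.1 p) (h.2 p), fun h => ⟨fun p hp => h p (.inl hp),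
    fun p hp => h p (.inr hp)⟩⟩

theorem IsAlgebraicVariety.iInter {ι : Type*} [Finite ι] {V : ι → Set (σ → ℂ)}
    (hV : ∀ i, IsAlgebraicVariety (V i)) : IsAlgebraicVariety (⋂ i, V i) := by
  classical
  cases nonempty_fintype ι
  choose S hS using hV
  refine ⟨Finset.univ.biUnion S, ?_⟩
  ext x
  simp only [hS, Set.mem_iInter, Set.mem_ofPred_eq, Finset.mem_biUnion, Finset.mem_univ, true_and]
  exact ⟨fun h p ⟨i, hi⟩ => h i p hi, fun h i p hi => h p ⟨i, hi⟩⟩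

theorem eval_bind₁_eq_eval (f : τ → MvPolynomial σ ℂ) (p : MvPolynomial τ ℂ) (x : σ → ℂ) :
    eval x (bind₁ f p) = eval (fun i => eval x (f i)) p := by
  simp only [← aeval_eq_eval, aeval_bind₁]

theorem IsAlgebraicVariety.preimage {V : Set (τ → ℂ)} (hV : IsAlgebraicVariety V)
    (f : τ → MvPolynomial σ ℂ) : IsAlgebraicVariety {x | (fun i => eval x (f i)) ∈ V} := by
  classical
  obtain ⟨S, rfl⟩ := hV
  refine ⟨S.image (bind₁ f), ?_⟩
  ext x
  simp [eval_bind₁_eq_eval]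

theorem varietyDim_empty : varietyDim (∅ : Set (σ → ℂ)) = ⊥ := by
  rw [varietyDim, vanishingIdeal_empty]
  exact ringKrullDim_eq_bot_of_subsingleton

theorem nontrivial_coordinateRing {V : Set (σ → ℂ)} (hV : V.Nonempty) :
    Nontrivial (MvPolynomial σ ℂ ⧸ vanishingIdeal ℂ V) := by
  obtain ⟨x, hx⟩ := hV
  refine Ideal.Quotient.nontrivial_iff.mpr fun h => ?_
  have : (1 : MvPolynomial σ ℂ) ∈ vanishingIdeal ℂ V := h ▸ Submodule.mem_top
  simpa using this x hx

theorem exists_varietyDim_eq_natCast [Finite σ] {V : Set (σ → ℂ)} (hV : V.Nonempty) :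
    ∃ s : ℕ, varietyDim V = s := by
  have := nontrivial_coordinateRing hV
  exact exists_ringKrullDim_eq_natCast ℂ _

theorem varietyDim_zeroLocus_vanishingIdeal (S : Set (σ → ℂ)) :
    varietyDim (zeroLocus ℂ (vanishingIdeal ℂ S)) = varietyDim S := by
  have h : vanishingIdeal ℂ (zeroLocus ℂ (vanishingIdeal ℂ S)) = vanishingIdeal ℂ S :=
    le_antisymm (vanishingIdeal_anti_mono (zeroLocus_vanishingIdeal_le S))
      (le_vanishingIdeal_zeroLocus _)
  rw [varietyDim, varietyDim, h]

/-- The closure of the image of a variety under a polynomial map has at most the dimension of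
the variety. -/
theorem varietyDim_image_le [Finite σ] [Finite τ] (S : Set (σ → ℂ)) (f : τ → MvPolynomial σ ℂ) :
    varietyDim ((fun x i => eval x (f i)) '' S) ≤ varietyDim S := by
  have hmem (p : MvPolynomial τ ℂ) : p ∈ vanishingIdeal ℂ ((fun x i => eval x (f i)) '' S) ↔
      bind₁ f p ∈ vanishingIdeal ℂ S := by
    simp [aeval_eq_eval, eval_bind₁_eq_eval]
  have hle : vanishingIdeal ℂ ((fun x i => eval x (f i)) '' S) ≤
      (vanishingIdeal ℂ S).comap (bind₁ f) := fun p hp => (hmem p).mp hp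
  exact ringKrullDim_le_of_injective (k := ℂ) (Ideal.quotientMapₐ _ (bind₁ f) hle)
    (Ideal.quotientMap_injective' (H := hle) fun p hp => (hmem p).mpr hp)

/-- A prime containing a finite intersection of ideals contains one of them, so each chain of primes
lies over a single `S i`. -/
theorem varietyDim_iUnion_le {ι : Type*} [Finite ι] (S : ι → Set (σ → ℂ)) {N : WithBot ℕ∞}
    (h : ∀ i, varietyDim (S i) ≤ N) : varietyDim (⋃ i, S i) ≤ N := by
  cases nonempty_fintype ι
  have hI : vanishingIdeal ℂ (⋃ i, S i) = ⨅ i, vanishingIdeal ℂ (S i) := by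
    ext p
    simp only [mem_vanishingIdeal_iff, Set.mem_iUnion, Ideal.mem_iInf]
    exact ⟨fun h i x hx => h x ⟨i, hx⟩, fun h x ⟨i, hx⟩ => h i x hx⟩
  rw [varietyDim, ringKrullDim_quotient]
  refine iSup_le fun l => ?_
  obtain ⟨i, hi⟩ : ∃ i, vanishingIdeal ℂ (S i) ≤ l.head.1.asIdeal := by
    have hle : (Finset.univ.inf fun i => vanishingIdeal ℂ (S i)) ≤ l.head.1.asIdeal := by
      rw [Finset.inf_univ_eq_iInf, ← hI]
      exact l.head.2
    obtain ⟨i, -, hi⟩ := (Ideal.IsPrime.inf_le' l.head.1.isPrime).mp hle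
    exact ⟨i, hi⟩
  refine le_trans ?_ (h i)
  rw [varietyDim, ringKrullDim_quotient]
  let l' : LTSeries (PrimeSpectrum.zeroLocus (vanishingIdeal ℂ (S i) : Set (MvPolynomial σ ℂ))) :=
    LTSeries.mk l.length (fun k => ⟨(l k).1, hi.trans (LTSeries.head_le l k)⟩)
      fun _ _ hjk => l.strictMono hjk
  exact Order.LTSeries.length_le_krullDim l'

/-- Evaluation at a point of a variety, as a map on the coordinate ring. -/
noncomputable def evalPoint {V : Set (σ → ℂ)} {a : σ → ℂ} (ha : a ∈ V) :
    (MvPolynomial σ ℂ ⧸ vanishingIdeal ℂ V) →ₐ[ℂ] ℂ :=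
  Ideal.Quotient.liftₐ _ (aeval a) fun _ hp => hp a ha

@[simp]
theorem evalPoint_mk {V : Set (σ → ℂ)} {a : σ → ℂ} (ha : a ∈ V) (p : MvPolynomial σ ℂ) :
    evalPoint ha (Ideal.Quotient.mk _ p) = eval a p := by
  simp [evalPoint]

theorem exists_eq_ker_evalPoint [Finite σ] {V : Set (σ → ℂ)} (hV : IsAlgebraicVariety V)
    (M : Ideal (MvPolynomial σ ℂ ⧸ vanishingIdeal ℂ V)) [hM : M.IsMaximal] :
    ∃ (a : σ → ℂ) (ha : a ∈ V), M = RingHom.ker (evalPoint ha) := by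
  have := Ideal.comap_isMaximal_of_surjective (Ideal.Quotient.mk (vanishingIdeal ℂ V))
    Ideal.Quotient.mk_surjective (K := M)
  obtain ⟨a, ha⟩ := eq_vanishingIdeal_singleton_of_isMaximal ℂ this
  have haV : a ∈ V := by
    rw [← hV.zeroLocus_vanishingIdeal]
    intro p hp
    rw [← mem_vanishingIdeal_singleton_iff, ← ha, Ideal.mem_comap,
      Ideal.Quotient.eq_zero_iff_mem.mpr hp]
    exact M.zero_mem
  refine ⟨a, haV, ?_⟩
  ext b
  obtain ⟨p, rfl⟩ := Ideal.Quotient.mk_surjective b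
  rw [← Ideal.mem_comap, ha, mem_vanishingIdeal_singleton_iff, RingHom.mem_ker, evalPoint_mk,
    aeval_eq_eval]

/-- A finite dominant map to affine space is surjective. -/
theorem exists_evalPoint_comp_eq [Finite σ] [Finite τ] {V : Set (σ → ℂ)}
    (hV : IsAlgebraicVariety V)
    (g : MvPolynomial τ ℂ →ₐ[ℂ] MvPolynomial σ ℂ ⧸ vanishingIdeal ℂ V)
    (hinj : Function.Injective g) (hint : g.IsIntegral) (u : τ → ℂ) :
    ∃ (a : σ → ℂ) (ha : a ∈ V), (evalPoint ha).comp g = aeval u := by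
  obtain ⟨Q, hQ, hQu⟩ : ∃ Q : Ideal (MvPolynomial σ ℂ ⧸ vanishingIdeal ℂ V),
      Q.IsMaximal ∧ Q.comap g.toRingHom = vanishingIdeal ℂ {u} := by
    algebraize [g.toRingHom]
    exact Ideal.exists_ideal_over_maximal_of_isIntegral (vanishingIdeal ℂ {u})
      ((RingHom.injective_iff_ker_eq_bot _).mp hinj ▸ bot_le)
  obtain ⟨a, ha, rfl⟩ := exists_eq_ker_evalPoint hV Q
  refine ⟨a, ha, AlgHom.ext fun p => ?_⟩
  have hp : p - C (eval u p) ∈ vanishingIdeal ℂ {u} := by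
    simp [aeval_eq_eval]
  rw [← hQu, Ideal.mem_comap, RingHom.mem_ker] at hp
  have hC (c : ℂ) : evalPoint ha (g (C c)) = c := by
    simp
  simpa [hC, sub_eq_zero, aeval_eq_eval] using hp

end Varieties

/-! ### Products and fibres -/

theorem isAlgebraicVariety_productVariety {m d : ℕ} {V : Fin m → Set (Fin d → ℂ)}
    (hV : ∀ j, IsAlgebraicVariety (V j)) : IsAlgebraicVariety (productVariety V) := by
  have : productVariety V =
      ⋂ j, {A | (fun i => eval A (X (j, i) : MvPolynomial (Fin m × Fin d) ℂ)) ∈ V j} := by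
    ext A
    simp [productVariety]
  rw [this]
  exact .iInter fun j => (hV j).preimage _

/-- The map on coordinate rings induced by a factor projection of a product of varieties. -/
noncomputable def productVarietyProj {m d : ℕ} (V : Fin m → Set (Fin d → ℂ)) (j : Fin m) :
    (MvPolynomial (Fin d) ℂ ⧸ vanishingIdeal ℂ (V j)) →ₐ[ℂ]
      MvPolynomial (Fin m × Fin d) ℂ ⧸ vanishingIdeal ℂ (productVariety V) :=
  Ideal.quotientMapₐ _ (rename (Prod.mk j)) fun p hp A hA => by
    simpa [aeval_rename, Function.comp_def] using hp _ (hA j)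

@[simp]
theorem productVarietyProj_mk {m d : ℕ} (V : Fin m → Set (Fin d → ℂ)) (j : Fin m)
    (p : MvPolynomial (Fin d) ℂ) :
    productVarietyProj V j (Ideal.Quotient.mk _ p) =
      Ideal.Quotient.mk _ (rename (Prod.mk j) p) := rfl

theorem evalPoint_comp_productVarietyProj {m d : ℕ} {V : Fin m → Set (Fin d → ℂ)}
    {A : Fin m × Fin d → ℂ} (hA : A ∈ productVariety V) (j : Fin m) :
    (evalPoint hA).comp (productVarietyProj V j) = evalPoint (hA j) := by
  refine AlgHom.ext fun b => ?_
  obtain ⟨p, rfl⟩ := Ideal.Quotient.mk_surjective b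
  simp [eval_rename, Function.comp_def]

/-- Noether normalizations of the factors combine into one, `G`, of the product. Integrality is
checked on coordinates. For injectivity, every `u` lifts to a point of the product, factor by
factor, so a polynomial killed by `G` vanishes at every `u`. -/
theorem varietyDim_productVariety {m d : ℕ} {V : Fin m → Set (Fin d → ℂ)}
    (hV : ∀ j, IsAlgebraicVariety (V j)) :
    varietyDim (productVariety V) = ∑ j, varietyDim (V j) := by
  by_cases hne : ∃ j, V j = ∅
  · obtain ⟨j, hj⟩ := hne
    have h1 : productVariety V = ∅ := Set.eq_empty_of_forall_notMem fun A hA => by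
      simpa [hj] using hA j
    rw [h1, varietyDim_empty, eq_comm, WithBot.sum_eq_bot_iff]
    exact ⟨j, Finset.mem_univ j, by rw [hj, varietyDim_empty]⟩
  push Not at hne
  have hnt (j : Fin m) := nontrivial_coordinateRing (hne j)
  choose s g hinj hint using fun j => exists_integral_inj_algHom_of_fg ℂ
    (MvPolynomial (Fin d) ℂ ⧸ vanishingIdeal ℂ (V j))
  have hdim (j : Fin m) : varietyDim (V j) = s j := by
    rw [varietyDim, ringKrullDim_eq_of_isIntegral (g j).toRingHom (hint j) (hinj j)]
    simp [ringKrullDim_of_isNoetherianRing]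
  let G : MvPolynomial (Σ j, Fin (s j)) ℂ →ₐ[ℂ]
      MvPolynomial (Fin m × Fin d) ℂ ⧸ vanishingIdeal ℂ (productVariety V) :=
    aeval fun t => productVarietyProj V t.1 (g t.1 (X t.2))
  have hG (j : Fin m) : G.comp (rename (Sigma.mk j)) = (productVarietyProj V j).comp (g j) := by
    ext i
    simp [G]
  have hGinj : Function.Injective G := by
    rw [injective_iff_map_eq_zero]
    intro P hP
    refine MvPolynomial.funext fun u => ?_
    choose a ha hau using fun j => exists_evalPoint_comp_eq (hV j) (g j) (hinj j) (hint j)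
      fun i => u ⟨j, i⟩
    have hA : (fun t : Fin m × Fin d => a t.1 t.2) ∈ productVariety V := ha
    have hcomp : (evalPoint hA).comp G = aeval u := by
      ext ⟨j, i⟩
      have h1 := DFunLike.congr_fun (evalPoint_comp_productVarietyProj hA j) (g j (X i))
      have h2 := DFunLike.congr_fun (hau j) (X i)
      simp only [AlgHom.comp_apply, aeval_X] at h1 h2 ⊢
      simp only [G, aeval_X]
      rw [h1, ← h2]
    rw [map_zero, ← aeval_eq_eval, ← hcomp, AlgHom.comp_apply, hP, map_zero]
  have hGint : G.toRingHom.IsIntegral := by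
    intro b
    obtain ⟨p, rfl⟩ := Ideal.Quotient.mk_surjective b
    induction p using MvPolynomial.induction_on with
    | C c =>
      have : Ideal.Quotient.mk (vanishingIdeal ℂ (productVariety V)) (C c) = G.toRingHom (C c) :=
        (G.commutes c).symm
      rw [this]
      exact G.toRingHom.isIntegralElem_map
    | add p q hp hq => rw [map_add]; exact hp.add _ hq
    | mul_X p t hp =>
      rw [map_mul]
      refine hp.mul _ ?_
      obtain ⟨j, i⟩ := t
      obtain ⟨q, hq, hq'⟩ := hint j (Ideal.Quotient.mk _ (X i))
      refine ⟨q.map (rename (Sigma.mk j) : _ →ₐ[ℂ] MvPolynomial (Σ j, Fin (s j)) ℂ).toRingHom,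
        hq.map _, ?_⟩
      have h1 : Ideal.Quotient.mk (vanishingIdeal ℂ (productVariety V)) (X (j, i)) =
          (productVarietyProj V j).toRingHom (Ideal.Quotient.mk _ (X i)) := by simp
      have h2 : G.toRingHom.comp (rename (Sigma.mk j) :
          _ →ₐ[ℂ] MvPolynomial (Σ j, Fin (s j)) ℂ).toRingHom =
          (productVarietyProj V j).toRingHom.comp (g j).toRingHom :=
        congrArg AlgHom.toRingHom (hG j)
      rw [Polynomial.eval₂_map, h2, h1, ← Polynomial.hom_eval₂]
      exact (congrArg _ hq').trans (map_zero _)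
  rw [varietyDim, ringKrullDim_eq_of_isIntegral G.toRingHom hGint hGinj]
  simp [ringKrullDim_of_isNoetherianRing, hdim]

/-- Primes see an ideal only through its radical; this lets a possibly nonreduced fibre be compared
with its set of points. -/
theorem ringKrullDim_quotient_le_of_le_radical {R : Type*} [CommRing R] {I J : Ideal R}
    (h : I ≤ J.radical) : ringKrullDim (R ⧸ J) ≤ ringKrullDim (R ⧸ I) := by
  rw [ringKrullDim_quotient, ringKrullDim_quotient]
  exact Order.krullDim_le_of_strictMono
    (fun p => ⟨p.1, h.trans (p.1.isPrime.radical_le_iff.mpr p.2)⟩) fun _ _ hpq => hpq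

/-- If a variety `E` lies over `Y` and all its fibres over points of `Y` have dimension at most
`c`, then `dim E ≤ dim Y + c`. -/
theorem varietyDim_le_add_of_fibre {σ τ : Type*} [Finite σ] [Finite τ]
    {E : Set (σ ⊕ τ → ℂ)} (hE : IsAlgebraicVariety E) {Y : Set (τ → ℂ)}
    (hEY : ∀ z ∈ E, z ∘ Sum.inr ∈ Y) {c : WithBot ℕ∞}
    (hc : ∀ y ∈ Y, varietyDim {a : σ → ℂ | Sum.elim a y ∈ E} ≤ c) :
    varietyDim E ≤ varietyDim Y + c := by
  let φ : (MvPolynomial τ ℂ ⧸ vanishingIdeal ℂ Y) →ₐ[ℂ]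
      MvPolynomial (σ ⊕ τ) ℂ ⧸ vanishingIdeal ℂ E :=
    Ideal.quotientMapₐ _ (rename Sum.inr) fun p hp z hz => by
      simpa [aeval_rename] using hp _ (hEY z hz)
  algebraize [φ.toRingHom]
  refine (ringKrullDim_le_iff_isMaximal_height_le _).mpr fun M hM => ?_
  obtain ⟨z, hz, hMz⟩ := exists_eq_ker_evalPoint hE M
  set y := z ∘ Sum.inr with hy
  set n : Ideal (MvPolynomial τ ℂ ⧸ vanishingIdeal ℂ Y) := M.under _ with hn
  have hnmem (p : MvPolynomial τ ℂ) (hp : eval y p = 0) : Ideal.Quotient.mk _ p ∈ n := by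
    rw [hn, Ideal.under, Ideal.mem_comap, hMz, RingHom.mem_ker]
    have h0 : algebraMap (MvPolynomial τ ℂ ⧸ vanishingIdeal ℂ Y)
        (MvPolynomial (σ ⊕ τ) ℂ ⧸ vanishingIdeal ℂ E) (Ideal.Quotient.mk _ p) =
        Ideal.Quotient.mk _ (rename Sum.inr p) := rfl
    rw [h0, evalPoint_mk, eval_rename, hp]
  set J := n.map (algebraMap (MvPolynomial τ ℂ ⧸ vanishingIdeal ℂ Y)
    (MvPolynomial (σ ⊕ τ) ℂ ⧸ vanishingIdeal ℂ E)) with hJ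
  -- The key inequality: the height of `M` is at most the height of `n` plus the height of `M` in
  -- the fibre ring modulo `J`.
  have h1 := Ideal.height_le_height_add_of_liesOver n M
  have h2 : (n.height : WithBot ℕ∞) ≤ varietyDim Y :=
    Ideal.height_le_ringKrullDim_of_ne_top (Ideal.IsPrime.ne_top inferInstance)
  have hJM : J ≤ M := Ideal.map_comap_le
  have h3 : ((M.map (Ideal.Quotient.mk J)).height : WithBot ℕ∞) ≤
      ringKrullDim ((MvPolynomial (σ ⊕ τ) ℂ ⧸ vanishingIdeal ℂ E) ⧸ J) := by
    refine Ideal.height_le_ringKrullDim_of_ne_top fun htop => hM.ne_top ?_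
    rw [← Ideal.comap_map_mk hJM, htop, Ideal.comap_top]
  have h4 : ringKrullDim ((MvPolynomial (σ ⊕ τ) ℂ ⧸ vanishingIdeal ℂ E) ⧸ J) ≤
      varietyDim {a : σ → ℂ | Sum.elim a y ∈ E} := by
    let π : MvPolynomial (σ ⊕ τ) ℂ →ₐ[ℂ] (MvPolynomial (σ ⊕ τ) ℂ ⧸ vanishingIdeal ℂ E) ⧸ J :=
      (Ideal.Quotient.mkₐ ℂ J).comp (Ideal.Quotient.mkₐ ℂ _)
    have hπ : Function.Surjective π :=
      Ideal.Quotient.mk_surjective.comp Ideal.Quotient.mk_surjective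
    -- Modulo `J` the `τ`-coordinates become the constants `y t`, so the `σ`-coordinates alone
    -- generate the fibre ring.
    let ψ : MvPolynomial σ ℂ →ₐ[ℂ] (MvPolynomial (σ ⊕ τ) ℂ ⧸ vanishingIdeal ℂ E) ⧸ J :=
      π.comp (rename Sum.inl)
    let β : MvPolynomial (σ ⊕ τ) ℂ →ₐ[ℂ] MvPolynomial σ ℂ :=
      bind₁ (Sum.elim X fun t => C (y t))
    have hψβ : ψ.comp β = π := by
      ext (i | t)
      · simp [ψ, β]
      · have hmem := Ideal.mem_map_of_mem (algebraMap (MvPolynomial τ ℂ ⧸ vanishingIdeal ℂ Y)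
          (MvPolynomial (σ ⊕ τ) ℂ ⧸ vanishingIdeal ℂ E)) (hnmem (X t - C (y t)) (by simp))
        have h0 : algebraMap (MvPolynomial τ ℂ ⧸ vanishingIdeal ℂ Y)
            (MvPolynomial (σ ⊕ τ) ℂ ⧸ vanishingIdeal ℂ E)
            (Ideal.Quotient.mk _ (X t - C (y t))) =
            Ideal.Quotient.mk _ (X (Sum.inr t) - C (y t)) := by
          change Ideal.Quotient.mk _ (rename Sum.inr (X t - C (y t))) = _
          rw [map_sub, rename_X, rename_C]
        rw [h0, ← hJ, ← Ideal.Quotient.eq_zero_iff_mem] at hmem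
        have h5 : π (X (Sum.inr t) - C (y t)) = 0 := hmem
        rw [map_sub, sub_eq_zero] at h5
        rw [h5]
        simp [ψ, β]
    have hψ : Function.Surjective ψ := fun b => by
      obtain ⟨p, rfl⟩ := hπ b
      exact ⟨β p, DFunLike.congr_fun hψβ p⟩
    rw [← ringKrullDim_eq_of_ringEquiv (RingHom.quotientKerEquivOfSurjective hψ)]
    refine ringKrullDim_quotient_le_of_le_radical ?_
    rw [← vanishingIdeal_zeroLocus_eq_radical (K := ℂ)]
    refine vanishingIdeal_anti_mono fun a ha => ?_
    change Sum.elim a y ∈ E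
    rw [← hE.zeroLocus_vanishingIdeal]
    intro p hp
    have h6 : β p ∈ RingHom.ker ψ := by
      have h7 : π p = 0 := by
        change Ideal.Quotient.mk J (Ideal.Quotient.mk _ p) = 0
        rw [Ideal.Quotient.eq_zero_iff_mem.mpr hp, map_zero]
      rw [RingHom.mem_ker, ← h7]
      exact DFunLike.congr_fun hψβ p
    have h8 := ha _ h6
    rw [aeval_eq_eval, eval_bind₁_eq_eval] at h8
    rw [aeval_eq_eval, ← h8]
    congr 2
    ext (i | t) <;> simp
  calc (M.height : WithBot ℕ∞)
      ≤ (n.height : WithBot ℕ∞) + (M.map (Ideal.Quotient.mk J)).height := by exact_mod_cast h1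
    _ ≤ _ := add_le_add h2 (h3.trans (h4.trans (hc y (hEY z hz))))

/-! ### Cones -/

/-- A chain of primes over `K` extends downwards by a minimal prime of `I` below its head, strictly
because that prime does not contain `K`. -/
theorem ringKrullDim_quotient_add_one_le {R : Type*} [CommRing R] {I K : Ideal R} (hIK : I ≤ K)
    (h : ∀ q ∈ I.minimalPrimes, ¬ K ≤ q) : ringKrullDim (R ⧸ K) + 1 ≤ ringKrullDim (R ⧸ I) := by
  rw [ringKrullDim_quotient, ringKrullDim_quotient]
  cases isEmpty_or_nonempty (PrimeSpectrum.zeroLocus (K : Set R))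
  · simp [Order.krullDim_eq_bot]
  have : Nonempty (PrimeSpectrum.zeroLocus (I : Set R)) :=
    Nonempty.map (fun p => ⟨p.1, hIK.trans p.2⟩) ‹Nonempty (PrimeSpectrum.zeroLocus (K : Set R))›
  rw [Order.krullDim_eq_iSup_length, Order.krullDim_eq_iSup_length, ← WithBot.coe_one,
    ← WithBot.coe_add, ENat.iSup_add, WithBot.coe_le_coe, iSup_le_iff]
  intro l
  obtain ⟨q, hq, hql⟩ := Ideal.exists_minimalPrimes_le (hIK.trans l.head.2)
  let l' : LTSeries (PrimeSpectrum.zeroLocus (I : Set R)) :=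
    l.map (fun p => ⟨p.1, hIK.trans p.2⟩) fun _ _ h => h
  have hlt : (⟨⟨q, hq.1.1⟩, hq.1.2⟩ : PrimeSpectrum.zeroLocus (I : Set R)) < l'.head :=
    lt_of_le_of_ne hql fun heq => h q hq (by
      have : q = l.head.1.asIdeal := congrArg (fun p => p.1.asIdeal) heq
      exact this ▸ l.head.2)
  refine le_trans ?_ (le_iSup _ (l'.cons _ hlt))
  simp only [RelSeries.cons_length, l']
  exact le_of_eq (by push_cast; rfl)

section Cones

attribute [local instance] MvPolynomial.gradedAlgebra

/-- The homogeneous core of `q` is again a prime over `I`, so minimality makes it equal to `q`. -/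
theorem isHomogeneous_of_mem_minimalPrimes {A S : Type*} [CommRing A] [SetLike S A]
    [AddSubmonoidClass S A] (𝒜 : ℕ → S) [GradedRing 𝒜] {I q : Ideal A} (hI : I.IsHomogeneous 𝒜)
    (hq : q ∈ I.minimalPrimes) : q.IsHomogeneous 𝒜 := by
  have hle : I ≤ (q.homogeneousCore 𝒜).toIdeal := by
    rw [← hI.toIdeal_homogeneousCore_eq_self]
    exact Ideal.homogeneousCore_mono 𝒜 hq.1.2
  have : q = (q.homogeneousCore 𝒜).toIdeal :=
    le_antisymm (hq.2 ⟨hq.1.1.homogeneousCore, hle⟩ (Ideal.toIdeal_homogeneousCore_le 𝒜 q))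
      (Ideal.toIdeal_homogeneousCore_le 𝒜 q)
  rw [this]
  exact (q.homogeneousCore 𝒜).isHomogeneous

variable {σ : Type*}

theorem IsHomogeneousVariety.exists_isHomogeneous_ideal {W : Set (σ → ℂ)}
    (hW : IsHomogeneousVariety W) :
    ∃ I : Ideal (MvPolynomial σ ℂ), I.IsHomogeneous (homogeneousSubmodule σ ℂ) ∧
      zeroLocus ℂ I = W := by
  obtain ⟨S, hS, rfl⟩ := hW
  exact ⟨Ideal.span S, Ideal.homogeneous_span _ _ hS, zeroLocus_span _⟩

/-- The minimal primes of a cone are homogeneous; one containing `X i - 1` would contain its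
degree-zero part `-1`. -/
theorem varietyDim_inter_coord_eq_one_add_one_le [Finite σ] {W : Set (σ → ℂ)}
    (hW : IsHomogeneousVariety W) (i : σ) :
    varietyDim (W ∩ {x | x i = 1}) + 1 ≤ varietyDim W := by
  obtain ⟨I, hI, rfl⟩ := hW.exists_isHomogeneous_ideal
  refine ringKrullDim_quotient_add_one_le (vanishingIdeal_anti_mono Set.inter_subset_left)
    fun q hq hle => ?_
  rw [vanishingIdeal_zeroLocus_eq_radical, Ideal.radical_minimalPrimes] at hq
  have hmem : X i - 1 ∈ q := hle fun x hx => by simp [hx.2.out]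
  have h0 := isHomogeneous_of_mem_minimalPrimes _ hI hq 0 hmem
  have h1 : (DirectSum.decompose (homogeneousSubmodule σ ℂ) (X i - 1) 0 : MvPolynomial σ ℂ) =
      -1 := by
    rw [DirectSum.decompose_sub, DirectSum.sub_apply, AddSubgroupClass.coe_sub,
      DirectSum.decompose_of_mem_ne (i := 1) _ (isHomogeneous_X ℂ i) one_ne_zero,
      DirectSum.decompose_of_mem_same _ (isHomogeneous_one σ ℂ), zero_sub]
  rw [h1, neg_mem_iff] at h0
  exact hq.1.1.ne_top ((Ideal.eq_top_iff_one q).mpr h0)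

/-- A graded Nakayama lemma: if the forms of large degree lie in the ideal generated by the `b j`
with coefficients of smaller degree, then the algebra is finite over the `b j`. -/
theorem finite_aeval_of_forall_isHomogeneous {k B ι : Type*} [Field k] [CommRing B] [Algebra k B]
    [Finite σ] [Fintype ι] (π : MvPolynomial σ k →ₐ[k] B) (hπ : Function.Surjective π) (b : ι → B)
    (N : ℕ) (h : ∀ n ≥ N, ∀ f : MvPolynomial σ k, f.IsHomogeneous n →
      ∃ r < n, ∃ c : ι → MvPolynomial σ k, (∀ j, (c j).IsHomogeneous r) ∧
        π f = ∑ j, π (c j) * b j) :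
    (aeval b : MvPolynomial ι k →ₐ[k] B).Finite := by
  algebraize [(aeval b : MvPolynomial ι k →ₐ[k] B).toRingHom]
  have : IsScalarTower k (MvPolynomial ι k) B := .of_algHom (aeval b)
  have hsmul (p : MvPolynomial ι k) (x : B) : p • x = (aeval b p : B) * x := rfl
  -- The finitely many monomials of degree below `N` generate `B`: by strong induction on degree,
  -- larger forms reduce to coefficients of smaller degree.
  let M : Submodule (MvPolynomial ι k) B := Submodule.span _
    ((fun e : σ →₀ ℕ => π (monomial e 1)) '' {e | e.degree < N})
  have hM (n : ℕ) : ∀ f : MvPolynomial σ k, f.IsHomogeneous n → π f ∈ M := by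
    induction n using Nat.strong_induction_on with
    | _ n ih =>
    intro f hf
    rcases lt_or_ge n N with hn | hn
    · rw [f.as_sum, map_sum]
      refine Submodule.sum_mem _ fun e he => ?_
      have hmon : π (monomial e (coeff e f)) =
          (C (coeff e f) : MvPolynomial ι k) • π (monomial e 1) := by
        rw [hsmul, aeval_C, ← mul_one (coeff e f), ← smul_eq_mul, ← smul_monomial, map_smul,
          Algebra.smul_def, smul_eq_mul, mul_one]
      rw [hmon]
      refine M.smul_mem _ (Submodule.subset_span ⟨e, ?_, rfl⟩)
      have : e.degree = n := by
        by_contra hne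
        exact mem_support_iff.mp he (hf.coeff_eq_zero hne)
      exact this.trans_lt hn
    · obtain ⟨r, hr, c, hc, hfc⟩ := h n hn f hf
      rw [hfc]
      refine Submodule.sum_mem _ fun j _ => ?_
      have : π (c j) * b j = (X j : MvPolynomial ι k) • π (c j) := by
        rw [hsmul, aeval_X, mul_comm]
      rw [this]
      exact M.smul_mem _ (ih r hr _ (hc j))
  have htop : M = ⊤ := by
    refine eq_top_iff.mpr fun x _ => ?_
    obtain ⟨f, rfl⟩ := hπ x
    rw [← sum_homogeneousComponent f, map_sum]
    exact Submodule.sum_mem _ fun n _ => hM n _ (homogeneousComponent_isHomogeneous n f)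
  have hfin : Module.Finite (MvPolynomial ι k) B :=
    ⟨htop ▸ Submodule.fg_span ((Finsupp.finite_of_degree_lt N).image _)⟩
  exact hfin

/-- A cone meeting the common kernel of `m` linear forms only in the origin has dimension at
most `m`. -/
theorem varietyDim_le_of_forall_eq_zero [Finite σ] {m : ℕ} {W : Set (σ → ℂ)}
    (hW : IsHomogeneousVariety W) (ℓ : Fin m → MvPolynomial σ ℂ)
    (hℓ : ∀ j, (ℓ j).IsHomogeneous 1)
    (h : ∀ x ∈ W, (∀ j, eval x (ℓ j) = 0) → x = 0) : varietyDim W ≤ m := by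
  obtain ⟨I, hI, rfl⟩ := hW.exists_isHomogeneous_ideal
  set J := I ⊔ Ideal.span (Set.range ℓ) with hJ
  -- Nullstellensatz: `J` has no zero other than the origin.
  have hrad : idealOfVars σ ℂ ≤ J.radical := by
    rw [← vanishingIdeal_zeroLocus_eq_radical (K := ℂ), idealOfVars, Ideal.span_le]
    rintro _ ⟨i, rfl⟩ x hx
    have hx0 : x = 0 := h x (fun p hp => hx p (le_sup_left (a := I) hp)) fun j => by
      simpa [aeval_eq_eval] using
        hx (ℓ j) (le_sup_right (a := I) (Ideal.subset_span ⟨j, rfl⟩))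
    simp [hx0]
  obtain ⟨k, hk⟩ := Ideal.exists_pow_le_of_le_radical_of_fg hrad (idealOfVars_fg σ ℂ)
  -- Forms of degree at least `k` already lie in `J`; the threshold `k + 1` only ensures `n ≥ 1`, so
  -- that coefficients of degree `n - 1` make sense.
  have hfin := finite_aeval_of_forall_isHomogeneous
    (Ideal.Quotient.mkₐ ℂ (vanishingIdeal ℂ (zeroLocus ℂ I)))
    Ideal.Quotient.mk_surjective (fun j => Ideal.Quotient.mk _ (ℓ j)) (k + 1) fun n hn f hf => by
      obtain ⟨r, rfl⟩ : ∃ r, n = r + 1 := ⟨n - 1, by omega⟩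
      have hfJ : f ∈ J := hk <| (mem_pow_idealOfVars_iff' k f).mpr fun e he =>
        hf.coeff_eq_zero (by omega)
      obtain ⟨s, hs, t, ht, rfl⟩ := Submodule.mem_sup.mp hfJ
      obtain ⟨c, rfl⟩ := Ideal.mem_span_range_iff_exists_fun.mp ht
      let 𝒜 := homogeneousSubmodule σ ℂ
      -- Taking degree `r + 1` parts replaces each `c j` by its degree `r` part, while that of `s`
      -- stays in the homogeneous ideal `I`.
      refine ⟨r, by omega, fun j => DirectSum.decompose 𝒜 (c j) r,
        fun j => (DirectSum.decompose 𝒜 (c j) r).2, ?_⟩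
      have hdec := DirectSum.decompose_of_mem_same 𝒜 hf
      rw [DirectSum.decompose_add, DirectSum.add_apply, Submodule.coe_add,
        DirectSum.decompose_sum, DFinsupp.finsetSum_apply, AddSubmonoidClass.coe_finsetSum,
        Finset.sum_congr rfl fun j _ =>
          DirectSum.coe_decompose_mul_add_of_right_mem 𝒜 (a := c j) (i := r) (hℓ j)] at hdec
      rw [← hdec, map_add, map_sum]
      have hs' : (Ideal.Quotient.mkₐ ℂ (vanishingIdeal ℂ (zeroLocus ℂ I)))
          (DirectSum.decompose 𝒜 s (r + 1)) = 0 :=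
        Ideal.Quotient.eq_zero_iff_mem.mpr (le_vanishingIdeal_zeroLocus I (hI (r + 1) hs))
      rw [hs', zero_add]
      exact Finset.sum_congr rfl fun j _ => map_mul _ _ _
  refine (ringKrullDim_le_of_isIntegral _ (RingHom.Finite.to_isIntegral hfin)).trans ?_
  simp [ringKrullDim_of_isNoetherianRing]

end Cones

/-! ### The incidence variety -/

theorem IsHomogeneousVariety.smul_mem {σ : Type*} {W : Set (σ → ℂ)} (hW : IsHomogeneousVariety W)
    {x : σ → ℂ} (hx : x ∈ W) (c : ℂ) : c • x ∈ W := by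
  obtain ⟨S, hS, rfl⟩ := hW
  intro p hp
  obtain ⟨n, hn⟩ := hS p hp
  have h0 : eval x p = 0 := hx p hp
  have h1 : eval (c • x) p = c ^ n * eval x p := by
    rw [eval_eq, eval_eq, Finset.mul_sum]
    refine Finset.sum_congr rfl fun e he => ?_
    have hdeg : ∑ i ∈ e.support, e i = n := by
      by_contra hne
      exact mem_support_iff.mp he (hn.coeff_eq_zero hne)
    simp only [Pi.smul_apply, smul_eq_mul, mul_pow, Finset.prod_mul_distrib]
    rw [Finset.prod_pow_eq_pow_sum, hdeg]
    ring
  rw [h1, h0, mul_zero]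

/-- A linear function on `ℂ^σ` as a polynomial. -/
noncomputable def linearFormPoly {σ : Type*} [Fintype σ] [DecidableEq σ]
    (l : (σ → ℂ) →ₗ[ℂ] ℂ) : MvPolynomial σ ℂ :=
  ∑ i, C (l (Pi.single i 1)) * X i

theorem eval_linearFormPoly {σ : Type*} [Fintype σ] [DecidableEq σ] (l : (σ → ℂ) →ₗ[ℂ] ℂ)
    (x : σ → ℂ) : eval x (linearFormPoly l) = l x := by
  conv_rhs => rw [pi_eq_sum_univ' x, map_sum]
  simp [linearFormPoly, mul_comm]

theorem isHomogeneous_linearFormPoly {σ : Type*} [Fintype σ] [DecidableEq σ]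
    (l : (σ → ℂ) →ₗ[ℂ] ℂ) : (linearFormPoly l).IsHomogeneous 1 :=
  .sum _ _ _ fun i _ => isHomogeneous_C_mul_X _ i

/-- Stands in for the subtraction `D - k`, with `⊥` when `k` exceeds `D`; it turns additive bounds
into plain upper bounds. -/
theorem exists_add_natCast_le_iff (D : WithBot ℕ∞) (k : ℕ) :
    ∃ c : WithBot ℕ∞, ∀ x : WithBot ℕ∞, x + k ≤ D ↔ x ≤ c := by
  induction D with
  | bot => exact ⟨⊥, fun x => by simp⟩
  | coe e =>
    by_cases hke : (k : ℕ∞) ≤ e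
    · refine ⟨((e - k : ℕ∞) : WithBot ℕ∞), fun x => ?_⟩
      induction x with
      | bot => simp
      | coe x =>
        rw [← WithBot.coe_natCast, ← WithBot.coe_add, WithBot.coe_le_coe, WithBot.coe_le_coe]
        exact (ENat.addLECancellable_natCast k).le_tsub_iff_right hke |>.symm
    · refine ⟨⊥, fun x => ?_⟩
      induction x with
      | bot => simp
      | coe x =>
        rw [← WithBot.coe_natCast, ← WithBot.coe_add, WithBot.coe_le_coe, le_bot_iff]
        simp only [WithBot.coe_ne_bot, iff_false]
        exact fun h => hke (le_add_self.trans h)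

theorem WithBot.add_one_le_of_lt_enat {a b : WithBot ℕ∞} (h : a < b) : a + 1 ≤ b := by
  induction a with
  | bot => simp
  | coe a =>
    induction b with
    | bot => exact absurd h not_lt_bot
    | coe b => exact WithBot.coe_le_coe.mpr (Order.add_one_le_of_lt (WithBot.coe_lt_coe.mp h))

section Incidence

variable {m d : ℕ} (L : (Fin d → ℂ) →ₗ[ℂ] (Fin d → ℂ) →ₗ[ℂ] ℂ)

/-- The pairs of a sample configuration in `V` and a point of `Y` that all its samples
annihilate. -/
def incidenceVariety (V : Fin m → Set (Fin d → ℂ)) (Y : Set (Fin d → ℂ)) :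
    Set ((Fin m × Fin d) ⊕ Fin d → ℂ) :=
  {z | z ∘ Sum.inl ∈ productVariety V ∧ z ∘ Sum.inr ∈ Y ∧
    linearSamples L (z ∘ Sum.inl) (z ∘ Sum.inr) = 0}

theorem isAlgebraicVariety_incidenceVariety {V : Fin m → Set (Fin d → ℂ)}
    (hV : ∀ j, IsAlgebraicVariety (V j)) {Y : Set (Fin d → ℂ)} (hY : IsAlgebraicVariety Y) :
    IsAlgebraicVariety (incidenceVariety L V Y) := by
  let q (j : Fin m) : MvPolynomial ((Fin m × Fin d) ⊕ Fin d) ℂ :=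
    ∑ a, ∑ b, C (L (Pi.single a 1) (Pi.single b 1)) * X (Sum.inl (j, a)) * X (Sum.inr b)
  have hq (j : Fin m) (z : (Fin m × Fin d) ⊕ Fin d → ℂ) :
      eval z (q j) = L (fun i => z (Sum.inl (j, i))) (z ∘ Sum.inr) := by
    rw [← LinearMap.flip_apply, ← eval_linearFormPoly]
    simp only [linearFormPoly, LinearMap.flip_apply, map_sum, map_mul, eval_C, eval_X, q]
    refine Finset.sum_congr rfl fun a _ => ?_
    rw [← eval_linearFormPoly (L (Pi.single a 1))]
    simp only [linearFormPoly, map_sum, map_mul, eval_C, eval_X, Finset.sum_mul]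
    exact Finset.sum_congr rfl fun b _ => by simp only [Function.comp_apply]; ring
  have heq : incidenceVariety L V Y =
      {z | (fun t => eval z (X (Sum.inl t))) ∈ productVariety V} ∩
        ({z | (fun t => eval z (X (Sum.inr t))) ∈ Y} ∩ ⋂ j, {z | eval z (q j) = 0}) := by
    ext z
    simp only [incidenceVariety, Set.mem_inter_iff, Set.mem_iInter, Set.mem_ofPred_eq, eval_X, hq,
      funext_iff, linearSamples]
    rfl
  rw [heq]
  exact ((isAlgebraicVariety_productVariety hV).preimage _).inter
    ((hY.preimage _).inter (.iInter fun j => isAlgebraicVariety_setOf_eval_eq_zero _))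

theorem varietyDim_productVariety_inter_add_le {V : Fin m → Set (Fin d → ℂ)}
    (hV : ∀ j, IsAlgebraicVariety (V j)) {l : (Fin d → ℂ) →ₗ[ℂ] ℂ}
    (hl : ∀ j, varietyDim (V j ∩ {a | l a = 0}) < varietyDim (V j)) :
    varietyDim (productVariety fun j => V j ∩ {a | l a = 0}) + m ≤
      varietyDim (productVariety V) := by
  have hl' : IsAlgebraicVariety {a | l a = 0} := by
    simpa only [eval_linearFormPoly] using
      isAlgebraicVariety_setOf_eval_eq_zero (linearFormPoly l)
  rw [varietyDim_productVariety hV, varietyDim_productVariety fun j => (hV j).inter hl']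
  calc ∑ j, varietyDim (V j ∩ {a | l a = 0}) + (m : WithBot ℕ∞)
      = ∑ j, (varietyDim (V j ∩ {a | l a = 0}) + 1) := by simp [Finset.sum_add_distrib]
    _ ≤ ∑ j, varietyDim (V j) := Finset.sum_le_sum fun j _ =>
        WithBot.add_one_le_of_lt_enat (hl j)

theorem varietyDim_incidenceVariety_add_le {V : Fin m → Set (Fin d → ℂ)}
    (hV : ∀ j, IsAlgebraicVariety (V j)) {Y : Set (Fin d → ℂ)} (hY : IsAlgebraicVariety Y)
    (hadm : ∀ y ∈ Y, ∀ j, varietyDim (V j ∩ {a | L.flip y a = 0}) < varietyDim (V j)) :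
    varietyDim (incidenceVariety L V Y) + m ≤ varietyDim Y + varietyDim (productVariety V) := by
  obtain ⟨c, hc⟩ := exists_add_natCast_le_iff (varietyDim (productVariety V)) m
  have hle : varietyDim (incidenceVariety L V Y) ≤ varietyDim Y + c := by
    refine varietyDim_le_add_of_fibre (isAlgebraicVariety_incidenceVariety L hV hY)
      (fun z hz => hz.2.1) fun y hy => (hc _).mp ?_
    have heq : {A : Fin m × Fin d → ℂ | Sum.elim A y ∈ incidenceVariety L V Y} =
        productVariety fun j => V j ∩ {a | L.flip y a = 0} := by
      ext A
      simp only [incidenceVariety, productVariety, linearSamples, funext_iff, Set.mem_ofPred_eq,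
        Sum.elim_comp_inl, Sum.elim_comp_inr, hy, true_and, Set.mem_inter_iff,
        LinearMap.flip_apply, forall_and, Pi.zero_apply]
    rw [heq]
    exact varietyDim_productVariety_inter_add_le hV (hadm y hy)
  calc _ ≤ varietyDim Y + c + m := by gcongr
    _ = varietyDim Y + (c + m) := add_assoc _ _ _
    _ ≤ _ := by gcongr; exact (hc c).mpr le_rfl

theorem exists_exceptional_variety {W : Set (Fin d → ℂ)} (hW : IsHomogeneousVariety W)
    {V : Fin m → Set (Fin d → ℂ)} (hV : ∀ j, IsAlgebraicVariety (V j))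
    (hadm : ∀ j, IsAdmissible (V j) {l | ∃ x ∈ W \ {0}, l = L.flip x}) :
    ∃ Z : Set (Fin m × Fin d → ℂ), IsAlgebraicVariety Z ∧ Z ⊆ productVariety V ∧
      varietyDim Z + ((m + 1 : ℕ) : WithBot ℕ∞) ≤
        varietyDim (productVariety V) + varietyDim W ∧
      ∀ A ∈ productVariety V \ Z, ∀ x ∈ W, linearSamples L A x = 0 → x = 0 := by
  have hVp := isAlgebraicVariety_productVariety hV
  let Y (i : Fin d) : Set (Fin d → ℂ) := W ∩ {x | x i = 1}
  let S (i : Fin d) : Set (Fin m × Fin d → ℂ) :=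
    (fun z t => eval z (X (Sum.inl t))) '' incidenceVariety L V (Y i)
  have hY (i : Fin d) : IsAlgebraicVariety (Y i) := by
    refine hW.isAlgebraicVariety.inter ?_
    have heq : {x : Fin d → ℂ | x i = 1} = {x | eval x (X i - 1) = 0} := by
      ext x
      simp [sub_eq_zero]
    exact heq ▸ isAlgebraicVariety_setOf_eval_eq_zero _
  have hS (i : Fin d) : varietyDim (S i) + ((m + 1 : ℕ) : WithBot ℕ∞) ≤
      varietyDim (productVariety V) + varietyDim W := by
    have h1 := varietyDim_incidenceVariety_add_le L hV (hY i) fun y hy j =>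
      hadm j _ ⟨y, ⟨hy.1, fun h0 => by
        rw [Set.mem_singleton_iff] at h0
        simpa [h0] using hy.2.out⟩, rfl⟩
    calc varietyDim (S i) + ((m + 1 : ℕ) : WithBot ℕ∞)
        ≤ varietyDim (incidenceVariety L V (Y i)) + ((m + 1 : ℕ) : WithBot ℕ∞) := by
          gcongr; exact varietyDim_image_le _ _
      _ = varietyDim (incidenceVariety L V (Y i)) + m + 1 := by push_cast; rw [add_assoc]
      _ ≤ varietyDim (Y i) + varietyDim (productVariety V) + 1 := by gcongr
      _ = varietyDim (productVariety V) + (varietyDim (Y i) + 1) := by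
          rw [add_comm (varietyDim (Y i)), add_assoc]
      _ ≤ _ := by gcongr; exact varietyDim_inter_coord_eq_one_add_one_le hW i
  -- The projections `S i` need not be closed; their Zariski closure has the same vanishing ideal,
  -- hence the same dimension.
  refine ⟨zeroLocus ℂ (vanishingIdeal ℂ (⋃ i, S i)), isAlgebraicVariety_zeroLocus _, ?_, ?_, ?_⟩
  · have hsub : ⋃ i, S i ⊆ productVariety V := by
      refine Set.iUnion_subset fun i => ?_
      rintro _ ⟨z, hz, rfl⟩
      simpa [Function.comp_def] using hz.1
    rw [← hVp.zeroLocus_vanishingIdeal]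
    exact zeroLocus_anti_mono (vanishingIdeal_anti_mono hsub)
  · obtain ⟨c, hc⟩ := exists_add_natCast_le_iff
      (varietyDim (productVariety V) + varietyDim W) (m + 1)
    rw [varietyDim_zeroLocus_vanishingIdeal, hc]
    exact varietyDim_iUnion_le _ fun i => (hc _).mp (hS i)
  · rintro A ⟨hAV, hAZ⟩ x hx hAx
    by_contra hne
    obtain ⟨i, hi⟩ := Function.ne_iff.mp hne
    -- Rescaling by `(x i)⁻¹` moves `x` into the `i`-th chart, within the cone `W` and the kernel of
    -- `L_A`.
    refine hAZ (zeroLocus_vanishingIdeal_le _ (Set.mem_iUnion.mpr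
      ⟨i, Sum.elim A ((x i)⁻¹ • x), ⟨hAV, ⟨hW.smul_mem hx _, ?_⟩, ?_⟩, ?_⟩))
    · simpa using inv_mul_cancel₀ hi
    · ext j
      have := congrFun hAx j
      simp only [linearSamples, Pi.zero_apply] at this
      simp [linearSamples, this]
    · ext t
      simp

theorem varietyDim_le_of_linearSamples_injective {W : Set (Fin d → ℂ)}
    (hW : IsHomogeneousVariety W) (A : Fin m × Fin d → ℂ)
    (h : ∀ x ∈ W, linearSamples L A x = 0 → x = 0) : varietyDim W ≤ m :=
  varietyDim_le_of_forall_eq_zero hW (fun j => linearFormPoly (L fun i => A (j, i)))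
    (fun _ => isHomogeneous_linearFormPoly _) fun x hx hA => h x hx <| funext fun j => by
      exact (eval_linearFormPoly _ _).symm.trans (hA j)

end Incidence

theorem mainTheorem1 {m d : ℕ}
    (L : (Fin d → ℂ) →ₗ[ℂ] (Fin d → ℂ) →ₗ[ℂ] ℂ)
    (W : Set (Fin d → ℂ)) (hW : IsHomogeneousVariety W)
    (V : Fin m → Set (Fin d → ℂ)) (hV : ∀ j, IsAlgebraicVariety (V j))
    (hadm : ∀ j, IsAdmissible (V j) {l | ∃ x ∈ W \ {0}, l = L.flip x}) :
    -- (i), where `dim Z ≤ dim V - (m - dim W + 1)` is written without subtraction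
    (varietyDim W ≤ (m : WithBot ℕ∞) →
      ∃ Z : Set (Fin m × Fin d → ℂ), IsAlgebraicVariety Z ∧ Z ⊆ productVariety V ∧
        varietyDim Z + ((m + 1 : ℕ) : WithBot ℕ∞) ≤
          varietyDim (productVariety V) + varietyDim W ∧
        ∀ A ∈ productVariety V \ Z, ∀ x ∈ W, linearSamples L A x = 0 → x = 0) ∧
    -- (ii)
    ((m : WithBot ℕ∞) < varietyDim W →
      ∀ A ∈ productVariety V, ∃ x₀ ∈ W, x₀ ≠ 0 ∧ linearSamples L A x₀ = 0) ∧
    -- `m` measurements can suffice exactly when `m ≥ dim W`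
    ((productVariety V).Nonempty →
      ((∃ A ∈ productVariety V, ∀ x ∈ W, linearSamples L A x = 0 → x = 0) ↔
        varietyDim W ≤ (m : WithBot ℕ∞))) := by
  obtain ⟨Z, hZ, hZV, hdim, hinj⟩ := exists_exceptional_variety L hW hV hadm
  refine ⟨fun _ => ⟨Z, hZ, hZV, hdim, hinj⟩, fun hlt A _ => ?_, fun hne => ⟨?_, fun hle => ?_⟩⟩
  · by_contra! h
    refine hlt.not_ge (varietyDim_le_of_linearSamples_injective L hW A fun x hx hA => ?_)
    by_contra hx0
    exact h x hx hx0 hA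
  · rintro ⟨A, -, hA⟩
    exact varietyDim_le_of_linearSamples_injective L hW A hA
  · suffices ¬ productVariety V ⊆ Z by
      obtain ⟨A, hA, hAZ⟩ := Set.not_subset.mp this
      exact ⟨A, hA, hinj A ⟨hA, hAZ⟩⟩
    intro hVZ
    -- Cancellation needs `dim V` to be a natural number: `⊥` and `⊤` would absorb the extra `1`.
    obtain ⟨N, hN⟩ := exists_varietyDim_eq_natCast hne
    have h : varietyDim (productVariety V) + ((m + 1 : ℕ) : WithBot ℕ∞) ≤
        varietyDim (productVariety V) + m := by
      rw [← hZV.antisymm hVZ] at hdim ⊢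
      exact hdim.trans (by gcongr)
    rw [hN] at h
    have : N + (m + 1) ≤ N + m := by exact_mod_cast h
    omega
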